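/- Let $\nu>0$, $\mu_1,\mu_2\in\mathbb{R}$, $\sigma>0$ and $-1<\rho<1$, and put $$\boldsymbol\mu=\begin{pmatrix}\mu_1\\ \mu_2\end{pmatrix},\qquad \boldsymbol\Sigma=\begin{pmatrix}\sigma^2&\rho\sigma\\ \rho\sigma&1\end{pmatrix},\qquad g_c(x)=\Big(1+\frac{x}{\nu}\Big)^{-(\nu+2)/2}\quad (x\ge 0).$$ Let $(Y^*,U^*)^\top$ be a random vector with the bivariate symmetric distribution ${\rm BSY}(\boldsymbol\mu,\boldsymbol\Sigma,g_c)$, that is, with joint density $$\boldsymbol y\mapsto \frac{1}{|\boldsymbol\Sigma|^{1/2}Z_{g_c}}\,g_c\big((\boldsymbol y-\boldsymbol\mu)^\top\boldsymbol\Sigma^{-1}(\boldsymbol y-\boldsymbol\mu)\big),\quad \boldsymbol y\in\mathbb{R}^2,\qquad Z_{g_c}=\pi\int_0^\infty g_c(u)\,du$$ (the bivariate Student-$t$ distribution with $\nu$ degrees of freedom). Then $\mathbb{P}(U^*>0)>0$, and the conditional distribution of $Y^*$ given $U^*>0$ has the probability density function $$f_{Y^*\mid U^*>0}(y)=\frac1\sigma\,f_\nu(r)\,\frac{F_{\nu+1}\Big(\sqrt{\dfrac{\nu+1}{\nu+r^2}}\;\Big[\dfrac{1}{\sqrt{1-\rho^2}}\,\mu_2+\dfrac{\rho}{\sqrt{1-\rho^2}}\,r\Big]\Big)}{F_\nu(\mu_2)},\qquad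 r=\frac{y-\mu_1}{\sigma},\quad y\in\mathbb{R},$$ where, for $k>0$, $f_k(t)=\dfrac{\Gamma((k+1)/2)}{\sqrt{k\pi}\,\Gamma(k/2)}\Big(1+\dfrac{t^2}{k}\Big)^{-(k+1)/2}$ and $F_k(x)=\int_{-\infty}^x f_k(t)\,dt$ are the density and the distribution function of the classic Student-$t$ distribution with $k$ degrees of freedom. -/

import Mathlib

open MeasureTheory ProbabilityTheory

noncomputable section

/-- `f` is a probability density function of the random variable `X` under `P`, with respect to
Lebesgue measure: `X` is absolutely continuous, `f` is nonnegative, and `f` is a version of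
Mathlib's density `pdf X P`. -/
structure IsDensityOf {Ω E : Type*} [MeasurableSpace Ω] [MeasureSpace E]
    (P : Measure Ω) (X : Ω → E) (f : E → ℝ) : Prop where
  hasPDF : HasPDF X P volume
  nonneg : ∀ x, 0 ≤ f x
  pdf_ae_eq : pdf X P volume =ᵐ[volume] fun x => ENNReal.ofReal (f x)

/-- The normalization constant `Z_g = π ∫₀^∞ g(u) du` of a bivariate density generator `g`. -/
def bsyNormalization (g : ℝ → ℝ) : ℝ :=
  Real.pi * ∫ u in Set.Ioi (0 : ℝ), g u

/-- The bivariate symmetric density with location `m`, dispersion matrix `S` and generator `g`: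
`|S|^{-1/2} Z_g⁻¹ g((y - m)ᵀ S⁻¹ (y - m))`. -/
def bsyPDF (m : Fin 2 → ℝ) (S : Matrix (Fin 2) (Fin 2) ℝ) (g : ℝ → ℝ) (y : Fin 2 → ℝ) : ℝ :=
  1 / (Real.sqrt S.det * bsyNormalization g) *
    g (dotProduct (y - m) (S⁻¹.mulVec (y - m)))

/-- The random vector `W` has the bivariate symmetric distribution `BSY(m, S, g)`. -/
def IsBSY {Ω : Type*} [MeasurableSpace Ω] (P : Measure Ω) (W : Ω → Fin 2 → ℝ)
    (m : Fin 2 → ℝ) (S : Matrix (Fin 2) (Fin 2) ℝ) (g : ℝ → ℝ) : Prop :=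
  IsDensityOf P W (bsyPDF m S g)

/-- The matrix with rows `(s₁², ρ s₁ s₂)` and `(ρ s₁ s₂, s₂²)`. -/
def dispersionMatrix (s₁ s₂ ρ : ℝ) : Matrix (Fin 2) (Fin 2) ℝ :=
  !![s₁ ^ 2, ρ * s₁ * s₂; ρ * s₁ * s₂, s₂ ^ 2]

/-- The density generator of the bivariate Student-t distribution with `ν` degrees of freedom. -/
def studentGenerator (ν : ℝ) (x : ℝ) : ℝ :=
  (1 + x / ν) ^ (-(ν + 2) / 2)

/-- The density of the univariate Student-t distribution with `ν` degrees of freedom. -/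
def studentTPDF (ν : ℝ) (t : ℝ) : ℝ :=
  Real.Gamma ((ν + 1) / 2) / (Real.sqrt (ν * Real.pi) * Real.Gamma (ν / 2)) *
    (1 + t ^ 2 / ν) ^ (-(ν + 1) / 2)

/-- The univariate Student-t distribution with `ν` degrees of freedom. -/
def studentTMeasure (ν : ℝ) : Measure ℝ :=
  volume.withDensity fun t => ENNReal.ofReal (studentTPDF ν t)

/-- The distribution function of the univariate Student-t distribution. -/
def studentTCDF (ν : ℝ) (x : ℝ) : ℝ :=
  cdf (studentTMeasure ν) x

end

/-! Put r = (y - μ₁)/σ and s = u - μ₂. Completing the square in r² - 2ρrs + s² splits the joint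
density into f_ν(r) times an f_{ν+1} density in s, centred at ρr and rescaled
(`studentGenerator_factorization`). Integrating over u > 0 turns the second factor into F_{ν+1},
which gives the numerator. The quadratic form is symmetric in r and s, so the same factorization
with the roles exchanged integrates y out and leaves f_ν(u - μ₂); hence P(U > 0) = F_ν(μ₂), which is
positive. `IsDensityOf.cond_fst` divides the two. That f_k has mass one comes from writing it as a
gamma mixture of Gaussians (`lintegral_studentTPDF`). -/

theorem studentTPDF_nonneg {k : ℝ} (hk : 0 < k) (t : ℝ) : 0 ≤ studentTPDF k t := by
  unfold studentTPDF
  have h1 : 0 < Real.Gamma ((k + 1) / 2) := Real.Gamma_pos_of_pos (by positivity)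
  have h2 : 0 < Real.Gamma (k / 2) := Real.Gamma_pos_of_pos (by positivity)
  positivity

theorem studentTPDF_pos {k : ℝ} (hk : 0 < k) (t : ℝ) : 0 < studentTPDF k t := by
  unfold studentTPDF
  have h1 : 0 < Real.Gamma ((k + 1) / 2) := Real.Gamma_pos_of_pos (by positivity)
  have h2 : 0 < Real.Gamma (k / 2) := Real.Gamma_pos_of_pos (by positivity)
  have h3 : 0 < k * Real.pi := by positivity
  positivity

@[fun_prop]
theorem measurable_studentTPDF (k : ℝ) : Measurable (studentTPDF k) := by
  unfold studentTPDF
  fun_prop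

theorem studentTPDF_neg (k t : ℝ) : studentTPDF k (-t) = studentTPDF k t := by
  simp [studentTPDF]

/-! ### Total mass of the Student-t density. -/

/-- The centred Gaussian density of precision `x` has total mass one. -/
theorem lintegral_gaussian_precision {x : ℝ} (hx : 0 < x) :
    ∫⁻ t : ℝ, ENNReal.ofReal (Real.sqrt (x / (2 * Real.pi)) * Real.exp (-(x / 2) * t ^ 2)) = 1 := by
  rw [← ofReal_integral_eq_lintegral_ofReal
    ((integrable_exp_neg_mul_sq (by positivity)).const_mul _)
    (Filter.Eventually.of_forall fun t => by positivity), integral_const_mul, integral_gaussian,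
    ← Real.sqrt_mul (by positivity)]
  have : x / (2 * Real.pi) * (Real.pi / (x / 2)) = 1 := by
    field_simp
  rw [this]
  simp

/-- The Student-t density is a gamma mixture of centred Gaussian densities. -/
theorem gammaPDFReal_mul_gaussian_precision {k : ℝ} (hk : 0 < k) (t : ℝ) {x : ℝ} (hx : 0 < x) :
    gammaPDFReal (k / 2) (k / 2) x *
        (Real.sqrt (x / (2 * Real.pi)) * Real.exp (-(x / 2) * t ^ 2)) =
      studentTPDF k t * gammaPDFReal ((k + 1) / 2) ((k + t ^ 2) / 2) x := by
  have hG1 : 0 < Real.Gamma ((k + 1) / 2) := Real.Gamma_pos_of_pos (by positivity)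
  have hG2 : 0 < Real.Gamma (k / 2) := Real.Gamma_pos_of_pos (by positivity)
  have hb : 0 < 1 + t ^ 2 / k := by positivity
  have hR : (k + t ^ 2) / 2 = k / 2 * (1 + t ^ 2 / k) := by field_simp
  have hexp : Real.exp (-((k + t ^ 2) / 2 * x)) =
      Real.exp (-(k / 2 * x)) * Real.exp (-(x / 2) * t ^ 2) := by
    rw [← Real.exp_add]; congr 1; ring
  have hxp : x ^ ((k + 1) / 2 - 1) = x ^ (k / 2 - 1) * Real.sqrt x := by
    rw [Real.sqrt_eq_rpow, ← Real.rpow_add hx]; congr 1; ring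
  have hbp : (1 + t ^ 2 / k) ^ (-(k + 1) / 2) * (1 + t ^ 2 / k) ^ ((k + 1) / 2) = 1 := by
    rw [← Real.rpow_add hb, neg_div, neg_add_cancel, Real.rpow_zero]
  have hkp : (k / 2) ^ ((k + 1) / 2) = (k / 2) ^ (k / 2) * Real.sqrt (k / 2) := by
    rw [Real.sqrt_eq_rpow, ← Real.rpow_add (by positivity)]; congr 1; ring
  have hs : Real.sqrt (k / 2) = Real.sqrt (k * Real.pi) / Real.sqrt (2 * Real.pi) := by
    rw [← Real.sqrt_div (by positivity)]; congr 1; field_simp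
  have hs0 : 0 < Real.sqrt (k * Real.pi) := Real.sqrt_pos.2 (by positivity)
  simp only [gammaPDFReal, if_pos hx.le, studentTPDF]
  rw [hexp, hxp, hR, Real.mul_rpow (by positivity) hb.le, hkp, hs, Real.sqrt_div hx.le]
  -- From here the two powers matter only through `hbp`, which says that their product is one.
  generalize (1 + t ^ 2 / k) ^ (-(k + 1) / 2) = p at *
  generalize (1 + t ^ 2 / k) ^ ((k + 1) / 2) = q at *
  have h2 : 0 < Real.sqrt (2 * Real.pi) := Real.sqrt_pos.2 (by positivity)
  generalize Real.sqrt (k * Real.pi) = s at *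
  generalize Real.sqrt (2 * Real.pi) = s' at *
  generalize Real.Gamma ((k + 1) / 2) = g at *
  generalize Real.Gamma (k / 2) = g' at *
  field_simp
  linear_combination (-1 : ℝ) * hbp

/-- By Tonelli, the mixture can be integrated in `t` first: each Gaussian contributes one, and the
gamma mixing density remains. -/
theorem lintegral_studentTPDF {k : ℝ} (hk : 0 < k) :
    ∫⁻ t, ENNReal.ofReal (studentTPDF k t) = 1 := by
  let G : ℝ → ℝ → ENNReal := fun t x => ENNReal.ofReal (gammaPDFReal (k / 2) (k / 2) x) *
    ENNReal.ofReal (Real.sqrt (x / (2 * Real.pi)) * Real.exp (-(x / 2) * t ^ 2))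
  have hGm : Measurable (Function.uncurry G) := by
    have := measurable_gammaPDFReal (k / 2) (k / 2)
    simp only [G, Function.uncurry_def]
    fun_prop
  have h1 (t : ℝ) : ENNReal.ofReal (studentTPDF k t) = ∫⁻ x, G t x := by
    have hk1 : 0 < (k + 1) / 2 := by positivity
    have hkt : 0 < (k + t ^ 2) / 2 := by positivity
    calc ENNReal.ofReal (studentTPDF k t)
        = ∫⁻ x, ENNReal.ofReal (studentTPDF k t) *
            gammaPDF ((k + 1) / 2) ((k + t ^ 2) / 2) x := by
          rw [lintegral_const_mul' _ _ ENNReal.ofReal_ne_top,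
            lintegral_gammaPDF_eq_one hk1 hkt, mul_one]
      _ = ∫⁻ x, G t x := by
          refine lintegral_congr_ae ?_
          -- The mixture identity requires `0 < x`; for `x < 0` both gamma densities vanish, and the
          -- point 0 is null.
          filter_upwards [Measure.ae_ne volume (0 : ℝ)] with x hx
          rcases lt_or_gt_of_ne hx with hx | hx
          · simp [G, gammaPDF, gammaPDFReal, not_le.2 hx]
          · simp only [G, gammaPDF]
            rw [← ENNReal.ofReal_mul (studentTPDF_nonneg hk t),
              ← gammaPDFReal_mul_gaussian_precision hk t hx,
              ENNReal.ofReal_mul (gammaPDFReal_nonneg (by positivity) (by positivity) x)]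
  simp_rw [h1]
  rw [lintegral_lintegral_swap hGm.aemeasurable]
  have hk2 : 0 < k / 2 := by positivity
  rw [← lintegral_gammaPDF_eq_one hk2 hk2]
  refine lintegral_congr_ae ?_
  filter_upwards [Measure.ae_ne volume (0 : ℝ)] with x hx
  simp only [G]
  rw [lintegral_const_mul' _ _ ENNReal.ofReal_ne_top]
  rcases lt_or_gt_of_ne hx with hx | hx
  · simp [gammaPDF, gammaPDFReal, not_le.2 hx]
  · rw [lintegral_gaussian_precision hx, mul_one, gammaPDF]

theorem isProbabilityMeasure_studentTMeasure {k : ℝ} (hk : 0 < k) :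
    IsProbabilityMeasure (studentTMeasure k) :=
  ⟨by rw [studentTMeasure, withDensity_apply _ MeasurableSet.univ, Measure.restrict_univ,
    lintegral_studentTPDF hk]⟩

theorem ofReal_studentTCDF {k : ℝ} (hk : 0 < k) (x : ℝ) :
    ENNReal.ofReal (studentTCDF k x) = ∫⁻ t in Set.Iio x, ENNReal.ofReal (studentTPDF k t) := by
  have := isProbabilityMeasure_studentTMeasure hk
  rw [studentTCDF, ofReal_cdf, studentTMeasure, withDensity_apply _ measurableSet_Iic,
    setLIntegral_congr Iio_ae_eq_Iic]

theorem measurable_studentTCDF (k : ℝ) : Measurable (studentTCDF k) :=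
  (monotone_cdf (studentTMeasure k)).measurable

theorem studentTCDF_nonneg (k x : ℝ) : 0 ≤ studentTCDF k x :=
  cdf_nonneg _ x

theorem studentTCDF_pos {k : ℝ} (hk : 0 < k) (x : ℝ) : 0 < studentTCDF k x := by
  rw [← ENNReal.ofReal_pos, ofReal_studentTCDF hk, lintegral_pos_iff_support (by fun_prop)]
  have : Function.support (fun t => ENNReal.ofReal (studentTPDF k t)) = Set.univ := by
    ext t
    simp [studentTPDF_pos hk t]
  simp [this]

/-- Change of variables `u ↦ c (b - u)` in a Lebesgue integral on the line. -/
theorem lintegral_comp_mul_sub {g : ℝ → ENNReal} (hg : Measurable g) {c : ℝ} (hc : 0 < c) (b : ℝ) :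
    ∫⁻ u, ENNReal.ofReal c * g (c * (b - u)) = ∫⁻ t, g t := by
  rw [lintegral_const_mul' _ _ ENNReal.ofReal_ne_top,
    lintegral_sub_left_eq_self (fun u => g (c * u)) b]
  conv_rhs => rw [← Real.smul_map_volume_mul_left hc.ne', lintegral_smul_measure,
    lintegral_map hg (by fun_prop), abs_of_pos hc]
  rfl

theorem lintegral_studentTPDF_comp {k : ℝ} (hk : 0 < k) {c : ℝ} (hc : 0 < c) (b : ℝ) :
    ∫⁻ u, ENNReal.ofReal (c * studentTPDF k (c * (u - b))) = 1 := by
  rw [← lintegral_studentTPDF hk,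
    ← lintegral_comp_mul_sub (g := fun t => ENNReal.ofReal (studentTPDF k t)) (by fun_prop) hc b]
  refine lintegral_congr fun u => ?_
  rw [ENNReal.ofReal_mul hc.le, ← studentTPDF_neg, ← mul_neg, neg_sub]

/-- The orientation-reversing substitution t = c(b - u) carries u > 0 to t < cb, and evenness of the
density absorbs the sign. -/
theorem setLIntegral_Ioi_studentTPDF_comp {k : ℝ} (hk : 0 < k) {c : ℝ} (hc : 0 < c) (b : ℝ) :
    ∫⁻ u in Set.Ioi 0, ENNReal.ofReal (c * studentTPDF k (c * (u - b))) =
      ENNReal.ofReal (studentTCDF k (c * b)) := by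
  rw [ofReal_studentTCDF hk, ← lintegral_indicator measurableSet_Iio,
    ← lintegral_indicator measurableSet_Ioi,
    ← lintegral_comp_mul_sub (Measurable.indicator (by fun_prop) measurableSet_Iio) hc b]
  refine lintegral_congr fun u => ?_
  by_cases hu : 0 < u
  · have : c * (b - u) < c * b := by nlinarith
    rw [Set.indicator_of_mem (by exact hu), Set.indicator_of_mem (by exact this),
      ENNReal.ofReal_mul hc.le, ← studentTPDF_neg, ← mul_neg, neg_sub]
  · have : ¬ c * (b - u) < c * b := by nlinarith
    rw [Set.indicator_of_notMem (by exact hu), Set.indicator_of_notMem (by exact this), mul_zero]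

/-! ### Normalization and factorization of the bivariate density. -/

theorem bsyNormalization_studentGenerator {ν : ℝ} (hν : 0 < ν) :
    bsyNormalization (studentGenerator ν) = 2 * Real.pi := by
  have hexp : -(ν + 2) / 2 < -1 := by linarith
  have h1 : ∫ u in Set.Ioi (0 : ℝ), studentGenerator ν u =
      ∫ u in Set.Ioi (0 : ℝ), (fun x => (1 + x) ^ (-(ν + 2) / 2)) (ν⁻¹ * u) := by
    simp only [studentGenerator, div_eq_inv_mul]
  have h2 : ∫ x in Set.Ioi (0 : ℝ), (1 + x) ^ (-(ν + 2) / 2) =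
      ∫ x in Set.Ioi (1 : ℝ), x ^ (-(ν + 2) / 2) := by
    have := (measurePreserving_add_left volume (1 : ℝ)).setIntegral_preimage_emb
      (measurableEmbedding_addLeft 1) (fun x : ℝ => x ^ (-(ν + 2) / 2)) (Set.Ioi 1)
    rw [← this]
    simp
  rw [bsyNormalization, h1,
    integral_comp_mul_left_Ioi (fun x : ℝ => (1 + x) ^ (-(ν + 2) / 2)) 0 (inv_pos.2 hν), mul_zero, h2,
    integral_Ioi_rpow_of_lt hexp one_pos, Real.one_rpow]
  have : -(ν + 2) / 2 + 1 = -ν / 2 := by ring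
  rw [this]
  simp only [inv_inv, smul_eq_mul]
  field_simp

/-- The product of the normalizing constants of the Student-t densities with `ν` and `ν + 1`
degrees of freedom. -/
theorem studentT_normalization_mul {ν : ℝ} (hν : 0 < ν) :
    Real.Gamma ((ν + 1) / 2) / (Real.sqrt (ν * Real.pi) * Real.Gamma (ν / 2)) *
      (Real.Gamma ((ν + 1 + 1) / 2) /
        (Real.sqrt ((ν + 1) * Real.pi) * Real.Gamma ((ν + 1) / 2))) =
      Real.sqrt ν / (2 * Real.pi * Real.sqrt (ν + 1)) := by
  have hG1 : 0 < Real.Gamma ((ν + 1) / 2) := Real.Gamma_pos_of_pos (by positivity)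
  have hG2 : 0 < Real.Gamma (ν / 2) := Real.Gamma_pos_of_pos (by positivity)
  have hG3 : Real.Gamma ((ν + 1 + 1) / 2) = ν / 2 * Real.Gamma (ν / 2) := by
    rw [← Real.Gamma_add_one (by positivity)]; congr 1; ring
  have hs : 0 < Real.sqrt ν := Real.sqrt_pos.2 hν
  have hs1 : 0 < Real.sqrt (ν + 1) := Real.sqrt_pos.2 (by positivity)
  have hp : 0 < Real.sqrt Real.pi := Real.sqrt_pos.2 Real.pi_pos
  have hsq : Real.sqrt ν ^ 2 = ν := Real.sq_sqrt hν.le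
  have hpq : Real.sqrt Real.pi ^ 2 = Real.pi := Real.sq_sqrt Real.pi_pos.le
  rw [hG3, Real.sqrt_mul hν.le, Real.sqrt_mul (by positivity)]
  generalize Real.Gamma ((ν + 1) / 2) = g at *
  field_simp
  rw [hsq, hpq]

/-- The standardized bivariate Student-t density is the product of a univariate Student-t density
with `ν` degrees of freedom and a rescaled one with `ν + 1` degrees of freedom. -/
theorem studentGenerator_factorization {ν ρ : ℝ} (hν : 0 < ν) (hρ : 0 < 1 - ρ ^ 2) (r s : ℝ) :
    1 / (2 * Real.pi * Real.sqrt (1 - ρ ^ 2)) *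
        studentGenerator ν ((r ^ 2 - 2 * ρ * r * s + s ^ 2) / (1 - ρ ^ 2)) =
      studentTPDF ν r *
        (Real.sqrt ((ν + 1) / (ν + r ^ 2)) / Real.sqrt (1 - ρ ^ 2) *
          studentTPDF (ν + 1)
            (Real.sqrt ((ν + 1) / (ν + r ^ 2)) / Real.sqrt (1 - ρ ^ 2) * (s - ρ * r))) := by
  have hA : 0 < 1 + r ^ 2 / ν := by positivity
  have hνr : 0 < ν + r ^ 2 := by positivity
  set c := Real.sqrt ((ν + 1) / (ν + r ^ 2)) / Real.sqrt (1 - ρ ^ 2) with hc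
  have hc2 : c ^ 2 = (ν + 1) / (ν + r ^ 2) / (1 - ρ ^ 2) := by
    rw [hc, div_pow, Real.sq_sqrt (by positivity), Real.sq_sqrt hρ.le]
  have hB : 0 < 1 + (c * (s - ρ * r)) ^ 2 / (ν + 1) := by positivity
  -- This rests on r² - 2ρrs + s² = (1 - ρ²)r² + (s - ρr)²; `c` is the scale that makes the
  -- remaining factor a Student-t kernel with ν + 1 degrees of freedom.
  have hfac : 1 + (r ^ 2 - 2 * ρ * r * s + s ^ 2) / (1 - ρ ^ 2) / ν =
      (1 + r ^ 2 / ν) * (1 + (c * (s - ρ * r)) ^ 2 / (ν + 1)) := by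
    rw [mul_pow, hc2]
    field_simp
    ring
  have hAp : (1 + r ^ 2 / ν) ^ (-(ν + 2) / 2) =
      (1 + r ^ 2 / ν) ^ (-(ν + 1) / 2) * (Real.sqrt ν / Real.sqrt (ν + r ^ 2)) := by
    have : Real.sqrt ν / Real.sqrt (ν + r ^ 2) = (1 + r ^ 2 / ν) ^ (-(1 : ℝ) / 2) := by
      rw [neg_div, Real.rpow_neg hA.le, ← Real.sqrt_eq_rpow, ← Real.sqrt_div hν.le,
        ← Real.sqrt_inv]
      congr 1
      field_simp
    rw [this, ← Real.rpow_add hA]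
    congr 1; ring
  have hn := studentT_normalization_mul hν
  have h2 : -(ν + 1 + 1) / 2 = -(ν + 2) / 2 := by ring
  simp only [studentGenerator, studentTPDF]
  rw [hfac, Real.mul_rpow hA.le hB.le, hAp, h2]
  generalize (1 + (c * (s - ρ * r)) ^ 2 / (ν + 1)) ^ (-(ν + 2) / 2) = b
  generalize (1 + r ^ 2 / ν) ^ (-(ν + 1) / 2) = a
  have key : 1 / (2 * Real.pi * Real.sqrt (1 - ρ ^ 2)) *
      (Real.sqrt ν / Real.sqrt (ν + r ^ 2)) = Real.sqrt ν / (2 * Real.pi * Real.sqrt (ν + 1)) * c := by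
    rw [hc, Real.sqrt_div (by positivity)]
    have hs1 : 0 < Real.sqrt (ν + 1) := Real.sqrt_pos.2 (by positivity)
    field_simp
  rw [← hn] at key
  linear_combination a * b * key

theorem bsyPDF_dispersionMatrix_studentGenerator {ν ρ σ : ℝ} (hν : 0 < ν) (hσ : 0 < σ)
    (hρ : 0 < 1 - ρ ^ 2) (μ₁ μ₂ y u : ℝ) :
    bsyPDF ![μ₁, μ₂] (dispersionMatrix σ 1 ρ) (studentGenerator ν) ![y, u] =
      1 / σ * (1 / (2 * Real.pi * Real.sqrt (1 - ρ ^ 2)) *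
        studentGenerator ν ((((y - μ₁) / σ) ^ 2 - 2 * ρ * ((y - μ₁) / σ) * (u - μ₂) +
          (u - μ₂) ^ 2) / (1 - ρ ^ 2))) := by
  have hdet : (dispersionMatrix σ 1 ρ).det = σ ^ 2 * (1 - ρ ^ 2) := by
    simp [dispersionMatrix, Matrix.det_fin_two]; ring
  have hq : dotProduct (![y, u] - ![μ₁, μ₂])
      ((dispersionMatrix σ 1 ρ)⁻¹.mulVec (![y, u] - ![μ₁, μ₂])) =
      (((y - μ₁) / σ) ^ 2 - 2 * ρ * ((y - μ₁) / σ) * (u - μ₂) + (u - μ₂) ^ 2) / (1 - ρ ^ 2) := by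
    rw [Matrix.inv_def, hdet, Ring.inverse_eq_inv', dispersionMatrix, Matrix.adjugate_fin_two]
    simp [dotProduct, Matrix.mulVec, Fin.sum_univ_two]
    field_simp
    ring
  rw [bsyPDF, hdet, hq, bsyNormalization_studentGenerator hν, Real.sqrt_mul (by positivity),
    Real.sqrt_sq hσ.le]
  have := Real.sqrt_pos.2 hρ
  field_simp

/-! ### Conditional densities from a joint density. -/

theorem IsDensityOf.aemeasurable_fst {Ω : Type*} [MeasurableSpace Ω] {P : Measure Ω} {Y U : Ω → ℝ}
    {f : (Fin 2 → ℝ) → ℝ} (h : IsDensityOf P (fun ω => ![Y ω, U ω]) f) : AEMeasurable Y P := by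
  have := h.hasPDF
  simpa using (aemeasurable_pi_iff.1 (HasPDF.aemeasurable (fun ω => ![Y ω, U ω]) P volume)) 0

theorem IsDensityOf.aemeasurable_snd {Ω : Type*} [MeasurableSpace Ω] {P : Measure Ω} {Y U : Ω → ℝ}
    {f : (Fin 2 → ℝ) → ℝ} (h : IsDensityOf P (fun ω => ![Y ω, U ω]) f) : AEMeasurable U P := by
  have := h.hasPDF
  simpa using (aemeasurable_pi_iff.1 (HasPDF.aemeasurable (fun ω => ![Y ω, U ω]) P volume)) 1

/-- The probability of a rectangle is the iterated integral of the joint density. -/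
theorem IsDensityOf.measure_preimage_inter {Ω : Type*} [MeasurableSpace Ω] {P : Measure Ω}
    {Y U : Ω → ℝ} {f : (Fin 2 → ℝ) → ℝ} (h : IsDensityOf P (fun ω => ![Y ω, U ω]) f)
    (hf : Measurable fun p : ℝ × ℝ => f ![p.1, p.2]) {A B : Set ℝ}
    (hA : MeasurableSet A) (hB : MeasurableSet B) :
    P (Y ⁻¹' A ∩ U ⁻¹' B) = ∫⁻ y in A, ∫⁻ u in B, ENNReal.ofReal (f ![y, u]) := by
  have hpdf := h.hasPDF
  have hm := HasPDF.aemeasurable (fun ω => ![Y ω, U ω]) P volume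
  let e := MeasurableEquiv.finTwoArrow (α := ℝ)
  have he : MeasurePreserving e := volume_preserving_finTwoArrow ℝ
  have hAB : MeasurableSet (e ⁻¹' (A ×ˢ B)) := e.measurable (hA.prod hB)
  have hset : Y ⁻¹' A ∩ U ⁻¹' B = (fun ω => ![Y ω, U ω]) ⁻¹' (e ⁻¹' (A ×ˢ B)) := by
    ext ω
    simp [e, MeasurableEquiv.finTwoArrow, MeasurableEquiv.piFinTwo]
  have hfe (x : Fin 2 → ℝ) : f x = f ![(e x).1, (e x).2] := by
    congr 1
    ext i
    fin_cases i <;> rfl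
  rw [hset, ← Measure.map_apply_of_aemeasurable hm hAB,
    map_eq_setLIntegral_pdf _ P volume hAB, lintegral_congr_ae (ae_restrict_of_ae h.pdf_ae_eq),
    lintegral_congr fun x => congrArg ENNReal.ofReal (hfe x),
    he.setLIntegral_comp_preimage (f := fun p : ℝ × ℝ => ENNReal.ofReal (f ![p.1, p.2]))
    (hA.prod hB) hf.ennreal_ofReal, Measure.volume_eq_prod, ← Measure.prod_restrict,
    lintegral_prod _ hf.ennreal_ofReal.aemeasurable]

/-- If the joint density of `(Y, U)` integrates over `u ∈ B` to `g y`, then `g / P (U ∈ B)` is the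
conditional density of `Y` given `U ∈ B`. -/
theorem IsDensityOf.cond_fst {Ω : Type*} [MeasurableSpace Ω] {P : Measure Ω}
    {Y U : Ω → ℝ} {f : (Fin 2 → ℝ) → ℝ} (h : IsDensityOf P (fun ω => ![Y ω, U ω]) f)
    (hf : Measurable fun p : ℝ × ℝ => f ![p.1, p.2]) {B : Set ℝ} (hB : MeasurableSet B)
    {g : ℝ → ℝ} (hg : Measurable g) (hg0 : ∀ y, 0 ≤ g y)
    (hfg : ∀ y, ∫⁻ u in B, ENNReal.ofReal (f ![y, u]) = ENNReal.ofReal (g y))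
    {c : ℝ} (hc : 0 < c) (hPc : P (U ⁻¹' B) = ENNReal.ofReal c) :
    IsDensityOf (ProbabilityTheory.cond P (U ⁻¹' B)) Y fun y => g y / c := by
  have hYm := h.aemeasurable_fst
  -- `U` is only a.e. measurable, so the conditioning event is only null-measurable.
  have hUB : NullMeasurableSet (U ⁻¹' B) P := h.aemeasurable_snd.nullMeasurableSet_preimage hB
  have hYc : AEMeasurable Y (ProbabilityTheory.cond P (U ⁻¹' B)) :=
    hYm.mono_ac cond_absolutelyContinuous
  have hgc : Measurable fun y => ENNReal.ofReal (g y / c) := by fun_prop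
  have hmap : (ProbabilityTheory.cond P (U ⁻¹' B)).map Y =
      volume.withDensity fun y => ENNReal.ofReal (g y / c) := by
    ext A hA
    rw [Measure.map_apply_of_aemeasurable hYc hA, withDensity_apply _ hA, ProbabilityTheory.cond,
      Measure.smul_apply, Measure.restrict_apply₀' hUB, h.measure_preimage_inter hf hA hB, hPc]
    simp_rw [hfg]
    rw [smul_eq_mul, ← lintegral_const_mul _ (by fun_prop)]
    refine lintegral_congr fun y => ?_
    rw [ENNReal.ofReal_div_of_pos hc, ENNReal.div_eq_inv_mul]
  have hpdf : HasPDF Y (ProbabilityTheory.cond P (U ⁻¹' B)) volume :=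
    hasPDF_of_map_eq_withDensity hYc _ hgc.aemeasurable hmap
  exact ⟨hpdf, fun y => div_nonneg (hg0 y) hc.le,
    (pdf.eq_of_map_eq_withDensity' _ hgc.aemeasurable).1 hmap⟩

/-! ### The conditional law of Y given U > 0. -/

theorem mainTheorem3 {Ω : Type*} [MeasurableSpace Ω] (P : Measure Ω) [IsProbabilityMeasure P]
    (Y U : Ω → ℝ) (μ₁ μ₂ σ ρ ν : ℝ) (hσ : 0 < σ) (hρ₁ : -1 < ρ) (hρ₂ : ρ < 1) (hν : 0 < ν)
    (hYU : IsBSY P (fun ω => ![Y ω, U ω]) ![μ₁, μ₂] (dispersionMatrix σ 1 ρ)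
      (studentGenerator ν)) :
    P {ω | 0 < U ω} ≠ 0 ∧
    IsDensityOf (ProbabilityTheory.cond P {ω | 0 < U ω}) Y (fun y =>
      1 / σ * studentTPDF ν ((y - μ₁) / σ) *
        (studentTCDF (ν + 1)
            (Real.sqrt ((ν + 1) / (ν + ((y - μ₁) / σ) ^ 2)) *
              (1 / Real.sqrt (1 - ρ ^ 2) * μ₂ +
                ρ / Real.sqrt (1 - ρ ^ 2) * ((y - μ₁) / σ))) /
          studentTCDF ν μ₂)) := by
  have hρ : 0 < 1 - ρ ^ 2 := by nlinarith
  have hν1 : 0 < ν + 1 := by linarith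
  have hsρ : 0 < Real.sqrt (1 - ρ ^ 2) := Real.sqrt_pos.2 hρ
  have hcoef (r : ℝ) : 0 < Real.sqrt ((ν + 1) / (ν + r ^ 2)) / Real.sqrt (1 - ρ ^ 2) :=
    div_pos (Real.sqrt_pos.2 (by positivity)) hsρ
  have hjoint (y u : ℝ) := bsyPDF_dispersionMatrix_studentGenerator hν hσ hρ μ₁ μ₂ y u
  have hf : Measurable fun p : ℝ × ℝ => bsyPDF ![μ₁, μ₂] (dispersionMatrix σ 1 ρ)
      (studentGenerator ν) ![p.1, p.2] := by
    simp_rw [hjoint, studentGenerator]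
    fun_prop
  have hsection (y : ℝ) : ∫⁻ u in Set.Ioi 0, ENNReal.ofReal (bsyPDF ![μ₁, μ₂]
      (dispersionMatrix σ 1 ρ) (studentGenerator ν) ![y, u]) =
      ENNReal.ofReal (1 / σ * studentTPDF ν ((y - μ₁) / σ) *
        studentTCDF (ν + 1) (Real.sqrt ((ν + 1) / (ν + ((y - μ₁) / σ) ^ 2)) *
          (1 / Real.sqrt (1 - ρ ^ 2) * μ₂ + ρ / Real.sqrt (1 - ρ ^ 2) * ((y - μ₁) / σ)))) := by
    have h0 : 0 ≤ 1 / σ * studentTPDF ν ((y - μ₁) / σ) :=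
      mul_nonneg (by positivity) (studentTPDF_nonneg hν _)
    simp_rw [hjoint, studentGenerator_factorization hν hρ, ← mul_assoc (1 / σ),
      ENNReal.ofReal_mul h0]
    rw [lintegral_const_mul' _ _ ENNReal.ofReal_ne_top]
    congr 1
    -- As a function of `u`, the Student-t factor is centred at μ₂ + ρr.
    simp_rw [sub_sub]
    rw [setLIntegral_Ioi_studentTPDF_comp hν1 (hcoef _)]
    congr 2
    ring
  have hmarginal (u : ℝ) : ∫⁻ y, ENNReal.ofReal (bsyPDF ![μ₁, μ₂]
      (dispersionMatrix σ 1 ρ) (studentGenerator ν) ![y, u]) =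
      ENNReal.ofReal (studentTPDF ν (u - μ₂)) := by
    set c := Real.sqrt ((ν + 1) / (ν + (u - μ₂) ^ 2)) / Real.sqrt (1 - ρ ^ 2) with hc
    have hfac (y : ℝ) : bsyPDF ![μ₁, μ₂] (dispersionMatrix σ 1 ρ) (studentGenerator ν) ![y, u] =
        studentTPDF ν (u - μ₂) * (c / σ * studentTPDF (ν + 1)
          (c / σ * (y - (μ₁ + ρ * σ * (u - μ₂))))) := by
      -- The roles of the coordinates are exchanged, so the `y`-dependence sits in a density of
      -- total mass one.
      have h := studentGenerator_factorization hν hρ (u - μ₂) ((y - μ₁) / σ)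
      rw [← hc] at h
      have harg : c * ((y - μ₁) / σ - ρ * (u - μ₂)) =
          c / σ * (y - (μ₁ + ρ * σ * (u - μ₂))) := by
        field_simp
        ring
      have hq : ((y - μ₁) / σ) ^ 2 - 2 * ρ * ((y - μ₁) / σ) * (u - μ₂) + (u - μ₂) ^ 2 =
          (u - μ₂) ^ 2 - 2 * ρ * (u - μ₂) * ((y - μ₁) / σ) + ((y - μ₁) / σ) ^ 2 := by ring
      rw [hjoint, hq, h, harg]
      ring
    simp_rw [hfac, ENNReal.ofReal_mul (studentTPDF_nonneg hν (u - μ₂))]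
    rw [lintegral_const_mul' _ _ ENNReal.ofReal_ne_top,
      lintegral_studentTPDF_comp hν1 (div_pos (hcoef _) hσ), mul_one]
  have hPU : P (U ⁻¹' Set.Ioi 0) = ENNReal.ofReal (studentTCDF ν μ₂) := by
    have h := IsDensityOf.measure_preimage_inter hYU hf MeasurableSet.univ
      (measurableSet_Ioi (a := (0 : ℝ)))
    rw [Set.preimage_univ, Set.univ_inter, Measure.restrict_univ,
      lintegral_lintegral_swap (by exact hf.ennreal_ofReal.aemeasurable)] at h
    simp_rw [hmarginal] at h
    rw [h]
    simpa using setLIntegral_Ioi_studentTPDF_comp hν one_pos μ₂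
  have hF := studentTCDF_pos hν μ₂
  refine ⟨?_, ?_⟩
  · change P (U ⁻¹' Set.Ioi 0) ≠ 0
    rw [hPU]
    exact (ENNReal.ofReal_pos.2 hF).ne'
  · have hm : Measurable fun y => 1 / σ * studentTPDF ν ((y - μ₁) / σ) *
        studentTCDF (ν + 1) (Real.sqrt ((ν + 1) / (ν + ((y - μ₁) / σ) ^ 2)) *
          (1 / Real.sqrt (1 - ρ ^ 2) * μ₂ + ρ / Real.sqrt (1 - ρ ^ 2) * ((y - μ₁) / σ))) :=
      Measurable.mul (by fun_prop) ((measurable_studentTCDF _).comp (by fun_prop))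
    have h := IsDensityOf.cond_fst hYU hf measurableSet_Ioi hm
      (fun y => mul_nonneg (mul_nonneg (by positivity) (studentTPDF_nonneg hν _))
        (studentTCDF_nonneg _ _)) hsection hF hPU
    simp only [mul_div_assoc] at h
    exact h
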